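/- Let $\overline{\mathbb{Q}}\subset\mathbb{C}$ be the field of algebraic numbers, and let $E_1$ be the elliptic curve $y^2=x^3+x$ with point at infinity $O$. For $n\ge 2$ let $E_1(\overline{\mathbb{Q}})[n]$ be the group of $n$-torsion points of $E_1(\overline{\mathbb{Q}})$, and let $$K_n:=\min_{\substack{T_1,T_2\in E_1(\overline{\mathbb{Q}})[n]\setminus\{O\}\\ T_1\neq\pm T_2}}\left\{\,|x(T_1)-x(T_2)|,\ |x(T_1)^{-1}-x(T_2)^{-1}|\,\right\},$$ where $|\cdot|$ is the complex absolute value and the second quantity is considered only for pairs with $x(T_1)x(T_2)\neq 0$. Then, for every integer $n\ge2$, the minimum $K_n$ exists and $$K_n\ \ge\ \frac{1}{2.5\cdot 10^{36}\cdot n^6}.$$ -/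

import Mathlib

/-- The field of algebraic numbers, as a subfield of `ℂ`. -/
abbrev QBar : Type := algebraicClosure ℚ ℂ

/-- The elliptic curve `E₁ : y² = x³ + x` over `ℚ`. -/
def curveE1 : WeierstrassCurve.Affine ℚ where
  a₁ := 0
  a₂ := 0
  a₃ := 0
  a₄ := 1
  a₆ := 0

/-- The group `E₁(ℚ̄)`; its zero element is the point at infinity `O`. -/
abbrev E1QBar : Type := (WeierstrassCurve.baseChange curveE1 QBar).toAffine.Point

/-- The abscissa of a point of `E₁(ℚ̄)`, as a complex number. The point at infinity has no abscissa;
the value `0` given to it here is never used. -/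
noncomputable def abscissa : E1QBar → ℂ
  | .zero => 0
  | .some x _ _ => (x : ℂ)

/-- The set `E₁(ℚ̄)[n] \ {O}` of non-trivial `n`-torsion points. -/
def nontrivialTorsion (n : ℕ) : Set E1QBar :=
  {T | n • T = 0 ∧ T ≠ 0}

/-- The set of all `|x(T₁) - x(T₂)|`, and of all `|x(T₁)⁻¹ - x(T₂)⁻¹|` with `x(T₁) x(T₂) ≠ 0`, where
`T₁` and `T₂` run through the non-trivial `n`-torsion points of `E₁` with `T₁ ≠ ± T₂`. -/
def separations (n : ℕ) : Set ℝ :=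
  {d | ∃ T₁ ∈ nontrivialTorsion n, ∃ T₂ ∈ nontrivialTorsion n, T₁ ≠ T₂ ∧ T₁ ≠ -T₂ ∧
    (d = ‖abscissa T₁ - abscissa T₂‖ ∨
      (abscissa T₁ * abscissa T₂ ≠ 0 ∧ d = ‖(abscissa T₁)⁻¹ - (abscissa T₂)⁻¹‖))}

/-- The minimal separation `K_n`. It is defined as an infimum; that the infimum is attained is
part of the theorem. -/
noncomputable def minSeparation (n : ℕ) : ℝ :=
  sInf (separations n)

open WeierstrassCurve.Affine Polynomial

/-! The bound rests on the symmetric formulas of `exists_addSub` for `x(P ± Q)`. Write `a`, `b` for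
the abscissae of two torsion points and `s`, `d` for those of their sum and difference. Then `(ab -
1)² = (a - b)² s d` and `2(a + b)(ab + 1) = (a - b)²(s + d)`. If `a - b` is small compared with a
bound `B` for `|s|` and `|d|`, the first relation forces `ab ≈ 1`, hence `a + b ≈ ±2`, and the
second fails (`norm_sub_ge_of_addSub`).

Sum and difference are again nontrivial torsion points, so `B = 100 n²` comes from
`norm_xNum_lt_of_nsmul_eq_zero`: a point of large abscissa lies near `O`, where `x(mT) ≈ x(T)/m²`,
so its first multiples cannot vanish. This gives a separation of order `n⁻²`, stronger than
required.

The minimum is attained because abscissae of `n`-torsion points are roots of a nonzero division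
polynomial (`exists_isMulPoly`). -/

/-! ### Duplication and addition formulas on the `x`-line. -/

/-- The first homogeneous coordinate of the image of a point of `E₁` on the `x`-line. -/
noncomputable def xNum (P : E1QBar) : QBar := P.xRep 0

/-- The second homogeneous coordinate of the image of a point of `E₁` on the `x`-line. -/
noncomputable def xDen (P : E1QBar) : QBar := P.xRep 1

@[simp] lemma xNum_zero : xNum 0 = 1 := rfl
@[simp] lemma xDen_zero : xDen 0 = 0 := rfl
@[simp] lemma xNum_neg (P : E1QBar) : xNum (-P) = xNum P := by simp [xNum]
@[simp] lemma xDen_neg (P : E1QBar) : xDen (-P) = xDen P := by simp [xDen]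

lemma xNum_some {x y : QBar} (h : (WeierstrassCurve.baseChange curveE1 QBar).toAffine.Nonsingular x y) :
    xNum (Point.some x y h) = x := rfl

lemma xDen_some {x y : QBar} (h : (WeierstrassCurve.baseChange curveE1 QBar).toAffine.Nonsingular x y) :
    xDen (Point.some x y h) = 1 := rfl

lemma nonsingular_curveE1_iff (x y : QBar) :
    (WeierstrassCurve.baseChange curveE1 QBar).toAffine.Nonsingular x y ↔ y ^ 2 = x ^ 3 + x := by
  rw [nonsingular_iff, equation_iff]
  simp only [WeierstrassCurve.baseChange, WeierstrassCurve.toAffine, WeierstrassCurve.map, curveE1,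
    map_zero, map_one]
  constructor
  · rintro ⟨h, -⟩
    linear_combination h
  · intro h
    refine ⟨by linear_combination h, ?_⟩
    by_contra! hc
    obtain ⟨h1, h2⟩ := hc
    have hy : y = 0 := by linear_combination h2 / 2
    subst hy
    have hx : x = 0 := by linear_combination x / 2 * h1 - 3 / 2 * h
    subst hx
    norm_num at h1

lemma xDen_eq_zero_iff {P : E1QBar} : xDen P = 0 ↔ P = 0 := by
  rcases P with _ | ⟨x, y, h⟩
  · exact ⟨fun _ => rfl, fun _ => rfl⟩
  · simp [xDen_some, Point.some_ne_zero]

lemma xDen_of_ne_zero {P : E1QBar} (hP : P ≠ 0) : xDen P = 1 := by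
  rcases P with _ | ⟨x, y, h⟩
  · exact absurd rfl hP
  · rfl

instance : IsAlgClosed QBar := (algebraicClosure.isAlgClosure ℚ ℂ).isAlgClosed

lemma exists_point (x : QBar) : ∃ P : E1QBar, xNum P = x ∧ P ≠ 0 := by
  obtain ⟨y, hy⟩ := IsAlgClosed.exists_pow_nat_eq (x ^ 3 + x) (n := 2) (by norm_num)
  exact ⟨Point.some x y ((nonsingular_curveE1_iff x y).2 hy), rfl, Point.some_ne_zero _⟩

lemma eq_or_eq_neg_of_xNum_eq {P Q : E1QBar} (hP : P ≠ 0) (hQ : Q ≠ 0) (h : xNum P = xNum Q) :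
    P = Q ∨ P = -Q := by
  apply Point.eq_or_eq_neg_of_xRep_eq_xRep
  funext i
  fin_cases i
  · exact h
  · exact (xDen_of_ne_zero hP).trans (xDen_of_ne_zero hQ).symm

lemma negY_curveE1 (x y : QBar) :
    (WeierstrassCurve.baseChange curveE1 QBar).toAffine.negY x y = -y := by
  simp [negY, WeierstrassCurve.baseChange, WeierstrassCurve.toAffine, WeierstrassCurve.map, curveE1]

lemma exists_double (P : E1QBar) : ∃ l : QBar, l ≠ 0 ∧
    (xNum P ^ 2 - xDen P ^ 2) ^ 2 = l * xNum (P + P) ∧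
    4 * (xNum P * xDen P) * (xNum P ^ 2 + xDen P ^ 2) = l * xDen (P + P) := by
  rcases P with _ | ⟨x, y, h⟩
  · refine ⟨1, one_ne_zero, ?_⟩
    change (xNum 0 ^ 2 - xDen 0 ^ 2) ^ 2 = 1 * xNum (0 + 0) ∧
      4 * (xNum 0 * xDen 0) * (xNum 0 ^ 2 + xDen 0 ^ 2) = 1 * xDen (0 + 0)
    simp
  have hE := (nonsingular_curveE1_iff x y).1 h
  by_cases hy : y = 0
  · rw [Point.add_self_of_Y_eq (by rw [negY_curveE1, hy, neg_zero])]
    simp only [xNum_some, xDen_some, xNum_zero, xDen_zero]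
    -- Here `2P = O`; the scalar is nonzero because `x² = 1` is incompatible with `x³ + x = 0`.
    refine ⟨(x ^ 2 - 1 ^ 2) ^ 2, ?_, by ring, ?_⟩
    · intro h0
      have h1 : x ^ 2 - 1 = 0 := by simpa using h0
      have h2 : x ≠ 0 := by rintro rfl; norm_num at h1
      have h3 : x * 2 = 0 := by
        subst hy
        linear_combination -hE - x * h1
      simp [h2] at h3
    · subst hy
      linear_combination -4 * hE
  · have hy' : y ≠ (WeierstrassCurve.baseChange curveE1 QBar).toAffine.negY x y := by
      rw [negY_curveE1]
      intro h0
      exact hy (by linear_combination h0 / 2)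
    rw [Point.add_self_of_Y_ne hy']
    simp only [xNum_some, xDen_some]
    refine ⟨4 * y ^ 2, by simpa using hy, ?_, by linear_combination -4 * hE⟩
    rw [slope_of_Y_ne rfl hy', negY_curveE1]
    simp only [addX, WeierstrassCurve.baseChange, WeierstrassCurve.toAffine, WeierstrassCurve.map,
      curveE1, map_zero, map_one]
    have h2 : y - -y = 2 * y := by ring
    rw [h2]
    field_simp
    linear_combination 32 * x * hE

/-- Addition and subtraction on the `x`-line of `E₁`. -/
lemma exists_addSub (P Q : E1QBar) : ∃ l : QBar, l ≠ 0 ∧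
    (xNum P * xNum Q - xDen P * xDen Q) ^ 2 = l * (xNum (P + Q) * xNum (P - Q)) ∧
    2 * (xNum P * xDen Q + xDen P * xNum Q) * (xNum P * xNum Q + xDen P * xDen Q) =
      l * (xNum (P + Q) * xDen (P - Q) + xDen (P + Q) * xNum (P - Q)) ∧
    (xNum P * xDen Q - xDen P * xNum Q) ^ 2 = l * (xDen (P + Q) * xDen (P - Q)) := by
  by_cases hP : P = 0
  · subst hP
    refine ⟨1, one_ne_zero, ?_⟩
    simp only [zero_add, zero_sub, xNum_neg, xDen_neg, xNum_zero, xDen_zero]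
    refine ⟨?_, ?_, ?_⟩ <;> ring
  by_cases hQ : Q = 0
  · subst hQ
    refine ⟨1, one_ne_zero, ?_⟩
    simp only [add_zero, sub_zero, xNum_zero, xDen_zero]
    refine ⟨?_, ?_, ?_⟩ <;> ring
  by_cases hx : xNum P = xNum Q
  · obtain ⟨l, hl, h1, h2⟩ := exists_double Q
    -- Now `P = ±Q`, so one of `P ± Q` is `O` and the formulas reduce to duplication.
    refine ⟨l, hl, ?_⟩
    rcases eq_or_eq_neg_of_xNum_eq hP hQ hx with rfl | rfl
    · simp only [sub_self, xNum_zero, xDen_zero]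
      refine ⟨?_, ?_, ?_⟩
      · linear_combination h1
      · linear_combination h2
      · ring
    · rw [neg_add_cancel, show -Q - Q = -(Q + Q) by abel]
      simp only [xNum_zero, xDen_zero, xNum_neg, xDen_neg]
      refine ⟨?_, ?_, ?_⟩
      · linear_combination h1
      · linear_combination h2
      · ring
  rcases P with _ | ⟨x₁, y₁, h₁⟩
  · exact absurd rfl hP
  rcases Q with _ | ⟨x₂, y₂, h₂⟩
  · exact absurd rfl hQ
  have e₁ := (nonsingular_curveE1_iff x₁ y₁).1 h₁
  have e₂ := (nonsingular_curveE1_iff x₂ y₂).1 h₂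
  replace hx : x₁ ≠ x₂ := hx
  have hx' : x₁ - x₂ ≠ 0 := sub_ne_zero.2 hx
  rw [sub_eq_add_neg (Point.some x₁ y₁ h₁), Point.neg_some, Point.add_of_X_ne hx,
    Point.add_of_X_ne hx]
  simp only [xNum_some, xDen_some, slope_of_X_ne hx, negY_curveE1]
  refine ⟨(x₁ - x₂) ^ 2, pow_ne_zero 2 hx', ?_, ?_, by ring⟩
  · simp only [addX, WeierstrassCurve.baseChange, WeierstrassCurve.toAffine, WeierstrassCurve.map,
      curveE1, map_zero, map_one]
    field_simp
    linear_combination (-2 * x₁ * x₂ ^ 2 - 2 * x₁ ^ 2 * x₂ + 2 * x₁ ^ 3 + 2 * x₂ ^ 3 + 2 * y₂ ^ 2 - y₁ ^ 2 - (x₁ ^ 3 + x₁)) * e₁ +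
      (-2 * x₁ * x₂ ^ 2 - 2 * x₁ ^ 2 * x₂ + 2 * x₁ ^ 3 + 2 * x₂ ^ 3 + 2 * (x₁ ^ 3 + x₁) - y₂ ^ 2 - (x₂ ^ 3 + x₂)) * e₂
  · simp only [addX, WeierstrassCurve.baseChange, WeierstrassCurve.toAffine, WeierstrassCurve.map,
      curveE1, map_zero, map_one]
    field_simp
    linear_combination (-2 : QBar) * e₁ - 2 * e₂

/-! ### Multiplication by `m` on the `x`-line and division polynomials. -/

/-- `(a : b)` are homogeneous coordinates of the image of `P` on the `x`-line. -/
def IsRep (P : E1QBar) (a b : QBar) : Prop :=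
  ∃ c : QBar, c ≠ 0 ∧ a = c * xNum P ∧ b = c * xDen P

lemma xNum_ne_zero_or (P : E1QBar) : xNum P ≠ 0 ∨ xDen P ≠ 0 := by
  rcases P with _ | ⟨x, y, h⟩
  · exact Or.inl one_ne_zero
  · exact Or.inr one_ne_zero

lemma IsRep.ne_zero {P : E1QBar} {a b : QBar} (h : IsRep P a b) : a ≠ 0 ∨ b ≠ 0 := by
  obtain ⟨c, hc, rfl, rfl⟩ := h
  simpa [hc] using xNum_ne_zero_or P

lemma IsRep.eq_zero_iff {P : E1QBar} {a b : QBar} (h : IsRep P a b) : b = 0 ↔ P = 0 := by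
  obtain ⟨c, hc, rfl, rfl⟩ := h
  simp [hc, xDen_eq_zero_iff]

lemma IsRep.exists_addSub {P Q : E1QBar} {a b t : QBar} (h : IsRep P a b) (hQ : Q ≠ 0)
    (ht : xNum Q = t) : ∃ l : QBar, l ≠ 0 ∧
    (a * t - b) ^ 2 = l * (xNum (P + Q) * xNum (P - Q)) ∧
    2 * (a + b * t) * (a * t + b) =
      l * (xNum (P + Q) * xDen (P - Q) + xDen (P + Q) * xNum (P - Q)) ∧
    (a - b * t) ^ 2 = l * (xDen (P + Q) * xDen (P - Q)) := by
  obtain ⟨c, hc, rfl, rfl⟩ := h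
  obtain ⟨l, hl, h1, h2, h3⟩ := _root_.exists_addSub P Q
  rw [xDen_of_ne_zero hQ, ht] at h1 h2 h3
  refine ⟨c ^ 2 * l, mul_ne_zero (pow_ne_zero 2 hc) hl, ?_, ?_, ?_⟩
  · linear_combination c ^ 2 * h1
  · linear_combination c ^ 2 * h2
  · linear_combination c ^ 2 * h3

/-- The three equations compare the coefficients of two products of binary linear forms. Cancelling
the factor that belongs to `D` leaves the one that belongs to `S`. -/
lemma isRep_of_symmetric {S D : E1QBar} {e f g h l : QBar} (hl : l ≠ 0) (hD : IsRep D e f)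
    (h1 : e * g = l * (xNum S * xNum D))
    (h2 : e * h + f * g = l * (xNum S * xDen D + xDen S * xNum D))
    (h3 : f * h = l * (xDen S * xDen D)) : IsRep S g h := by
  obtain ⟨c, hc, rfl, rfl⟩ := hD
  refine ⟨l / c, div_ne_zero hl hc, ?_, ?_⟩
  · by_cases hD : D = 0
    · subst hD
      simp only [xNum_zero, xDen_zero] at h1 h2 h3
      field_simp
      linear_combination h1
    · rw [xDen_of_ne_zero hD] at h2 h3
      field_simp
      linear_combination h2 - xNum D * h3
  · by_cases hD : D = 0
    · subst hD
      simp only [xNum_zero, xDen_zero] at h1 h2 h3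
      field_simp
      linear_combination h2
    · rw [xDen_of_ne_zero hD] at h2 h3
      field_simp
      linear_combination h3

/-- The fraction `A / B` describes multiplication by `m` on the `x`-line of `E₁`. -/
structure IsMulPoly (m : ℕ) (A B : QBar[X]) : Prop where
  monic : A.Monic
  natDegree_num : A.natDegree = m ^ 2
  natDegree_den : B.natDegree + 1 = m ^ 2
  leadingCoeff_den : B.leadingCoeff = (m : QBar) ^ 2
  isRep : ∀ P : E1QBar, P ≠ 0 → IsRep (m • P) (A.eval (xNum P)) (B.eval (xNum P))

lemma isMulPoly_one : IsMulPoly 1 X 1 where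
  monic := monic_X
  natDegree_num := by simp
  natDegree_den := by simp
  leadingCoeff_den := by simp
  isRep P hP := ⟨1, one_ne_zero, by simp, by simp [xDen_of_ne_zero hP]⟩

lemma isMulPoly_two : IsMulPoly 2 ((X ^ 2 - 1) ^ 2) (C 4 * (X ^ 3 + X)) := by
  have h1 : ((X : QBar[X]) ^ 2 - 1).Monic := monic_X_pow_sub_C 1 two_ne_zero
  have h2 : ((X : QBar[X]) ^ 2 - 1).natDegree = 2 := natDegree_X_pow_sub_C
  have h3 : ((X : QBar[X]) ^ 3 + X).natDegree = 3 := by compute_degree!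
  have h4 : ((X : QBar[X]) ^ 3 + X).Monic := by monicity!
  refine ⟨h1.pow 2, by rw [h1.natDegree_pow, h2]; norm_num, ?_, ?_, fun P hP => ?_⟩
  · rw [natDegree_C_mul (by norm_num), h3]; norm_num
  · rw [leadingCoeff_mul, leadingCoeff_C, h4.leadingCoeff]; norm_num
  · obtain ⟨l, hl, e1, e2⟩ := exists_double P
    rw [xDen_of_ne_zero hP] at e1 e2
    rw [two_nsmul]
    refine ⟨l, hl, ?_, ?_⟩
    · rw [← e1]; simp
    · rw [← e2]; simp; ring

/-- A common root would be the abscissa of a point whose multiple has coordinates `(0 : 0)`. -/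
lemma IsMulPoly.isCoprime {m : ℕ} {A B : QBar[X]} (h : IsMulPoly m A B) : IsCoprime A B := by
  rw [Polynomial.isCoprime_iff_aeval_ne_zero_of_isAlgClosed QBar QBar]
  intro x
  obtain ⟨P, rfl, hP⟩ := exists_point x
  simpa [coe_aeval_eq_eval] using (h.isRep P hP).ne_zero

/-- Since `(m + 2)P` and `mP` are the sum and difference of `(m + 1)P` and `P`, the new pair
consists of the quotients of `(AX - B)²` by `A₀` and of `(A - BX)²` by `B₀`. -/
lemma IsMulPoly.succ {m : ℕ} (hm : 1 ≤ m) {A₀ B₀ A B : QBar[X]} (h₀ : IsMulPoly m A₀ B₀)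
    (h : IsMulPoly (m + 1) A B) : ∃ A₁ B₁, IsMulPoly (m + 2) A₁ B₁ := by
  have key : ∀ P : E1QBar, P ≠ 0 → ∃ l : QBar, l ≠ 0 ∧
      ((A * X - B) ^ 2).eval (xNum P) = l * (xNum ((m + 2) • P) * xNum (m • P)) ∧
      (2 * (A + B * X) * (A * X + B)).eval (xNum P) =
        l * (xNum ((m + 2) • P) * xDen (m • P) + xDen ((m + 2) • P) * xNum (m • P)) ∧
      ((A - B * X) ^ 2).eval (xNum P) = l * (xDen ((m + 2) • P) * xDen (m • P)) := by
    intro P hP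
    obtain ⟨l, hl, e⟩ := (h.isRep P hP).exists_addSub hP rfl
    have s1 : (m + 1) • P + P = (m + 2) • P := (succ_nsmul P (m + 1)).symm
    have s2 : (m + 1) • P - P = m • P := by rw [succ_nsmul, add_sub_cancel_right]
    rw [s1, s2] at e
    exact ⟨l, hl, by simpa using e⟩
  have hA₀ : A₀ ≠ 0 := h₀.monic.ne_zero
  have hB₀ : B₀ ≠ 0 := by
    rw [← leadingCoeff_ne_zero, h₀.leadingCoeff_den]
    exact pow_ne_zero 2 (Nat.cast_ne_zero.2 (by lia))
  have hB : B ≠ 0 := by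
    rw [← leadingCoeff_ne_zero, h.leadingCoeff_den]
    exact pow_ne_zero 2 (Nat.cast_ne_zero.2 (by lia))
  -- The abscissa of `mP` is a root of the quadratic whose roots are those of `(m + 2)P` and `mP`.
  -- Coprimality of `A₀` and `B₀` then yields both divisibilities.
  have quad : (A * X - B) ^ 2 * B₀ ^ 2 - 2 * (A + B * X) * (A * X + B) * (A₀ * B₀) +
      (A - B * X) ^ 2 * A₀ ^ 2 = 0 := by
    apply Polynomial.funext
    intro x
    obtain ⟨P, rfl, hP⟩ := exists_point x
    obtain ⟨l, -, e1, e2, e3⟩ := key P hP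
    obtain ⟨c, -, c1, c2⟩ := h₀.isRep P hP
    have expand (U V W : QBar[X]) : (U * B₀ ^ 2 - V * (A₀ * B₀) + W * A₀ ^ 2).eval (xNum P) =
        U.eval (xNum P) * B₀.eval (xNum P) ^ 2 -
          V.eval (xNum P) * (A₀.eval (xNum P) * B₀.eval (xNum P)) +
          W.eval (xNum P) * A₀.eval (xNum P) ^ 2 := by simp
    rw [expand, e1, e2, e3, c1, c2, eval_zero]
    ring
  obtain ⟨G, hG⟩ : A₀ ∣ (A * X - B) ^ 2 := by
    refine (h₀.isCoprime.pow_right (n := 2)).dvd_of_dvd_mul_right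
      ⟨2 * (A + B * X) * (A * X + B) * B₀ - (A - B * X) ^ 2 * A₀, ?_⟩
    linear_combination quad
  obtain ⟨H, hH⟩ : B₀ ∣ (A - B * X) ^ 2 := by
    refine (h₀.isCoprime.symm.pow_right (n := 2)).dvd_of_dvd_mul_right
      ⟨2 * (A + B * X) * (A * X + B) * A₀ - (A * X - B) ^ 2 * B₀, ?_⟩
    linear_combination quad
  have mid : A₀ * H + B₀ * G = 2 * (A + B * X) * (A * X + B) := by
    apply mul_left_cancel₀ (mul_ne_zero hA₀ hB₀)
    linear_combination quad - B₀ ^ 2 * hG - A₀ ^ 2 * hH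
  have dB : B.natDegree + 1 = (m + 1) ^ 2 := h.natDegree_den
  have dlt : B.natDegree < (A * X).natDegree := by
    rw [h.monic.natDegree_mul monic_X, natDegree_X, h.natDegree_num]; lia
  have mU : (A * X - B).Monic :=
    (h.monic.mul monic_X).sub_of_left (degree_lt_degree dlt)
  have dU : (A * X - B).natDegree = (m + 1) ^ 2 + 1 := by
    rw [natDegree_sub_eq_left_of_natDegree_lt dlt, h.monic.natDegree_mul monic_X, natDegree_X,
      h.natDegree_num]
  -- `A` and `BX` have equal degree, and their leading coefficients differ by `-m(m + 2)`; its
  -- square over `m²` is the required `(m + 2)²`.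
  have cW : (A - B * X).coeff ((m + 1) ^ 2) = 1 - ((m + 1 : ℕ) : QBar) ^ 2 := by
    rw [coeff_sub, ← h.natDegree_num, h.monic.coeff_natDegree, h.natDegree_num, ← dB, coeff_mul_X,
      coeff_natDegree, h.leadingCoeff_den]
  have cW0 : (1 : QBar) - ((m + 1 : ℕ) : QBar) ^ 2 ≠ 0 := by
    have : ((m : QBar) * (m + 2 : ℕ)) ≠ 0 :=
      mul_ne_zero (Nat.cast_ne_zero.2 (by lia)) (Nat.cast_ne_zero.2 (by lia))
    intro h0
    apply this
    push_cast at h0 ⊢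
    linear_combination -h0
  have dW : (A - B * X).natDegree = (m + 1) ^ 2 := by
    apply natDegree_eq_of_le_of_coeff_ne_zero _ (by rwa [cW])
    refine (natDegree_sub_le _ _).trans (max_le h.natDegree_num.le ?_)
    rw [natDegree_mul_X hB, dB]
  have mG : G.Monic := by
    have := mU.pow 2
    rw [hG] at this
    exact h₀.monic.of_mul_monic_left this
  have hH0 : H ≠ 0 := by
    rintro rfl
    rw [mul_zero, sq_eq_zero_iff] at hH
    rw [hH, coeff_zero] at cW
    exact cW0 cW.symm
  refine ⟨G, H, mG, ?_, ?_, ?_, fun P hP => ?_⟩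
  · have := congrArg natDegree hG
    rw [mU.natDegree_pow, dU, h₀.monic.natDegree_mul mG, h₀.natDegree_num] at this
    nlinarith
  · have := congrArg natDegree hH
    have h1 := h₀.natDegree_den
    rw [natDegree_pow, dW, natDegree_mul hB₀ hH0] at this
    nlinarith
  · have := congrArg leadingCoeff hH
    rw [leadingCoeff_pow, leadingCoeff_mul, h₀.leadingCoeff_den, leadingCoeff, dW, cW] at this
    have hm0 : (m : QBar) ^ 2 ≠ 0 := pow_ne_zero 2 (Nat.cast_ne_zero.2 (by lia))
    apply mul_left_cancel₀ hm0
    rw [← this]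
    push_cast
    ring
  · obtain ⟨l, hl, e1, e2, e3⟩ := key P hP
    rw [hG, eval_mul] at e1
    rw [← mid, eval_add, eval_mul, eval_mul] at e2
    rw [hH, eval_mul] at e3
    exact isRep_of_symmetric hl (h₀.isRep P hP) e1 e2 e3

lemma exists_isMulPoly (m : ℕ) (hm : 1 ≤ m) : ∃ A B, IsMulPoly m A B := by
  have : ∀ k : ℕ, (∃ A B, IsMulPoly (k + 1) A B) ∧ ∃ A B, IsMulPoly (k + 2) A B := by
    intro k
    induction k with
    | zero => exact ⟨⟨_, _, isMulPoly_one⟩, ⟨_, _, isMulPoly_two⟩⟩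
    | succ k ih =>
      obtain ⟨⟨A₀, B₀, h₀⟩, ⟨A, B, h⟩⟩ := ih
      exact ⟨⟨A, B, h⟩, h₀.succ (by lia) h⟩
  obtain ⟨k, rfl⟩ := Nat.exists_eq_add_of_le' hm
  exact (this k).1

/-- Multiplication on the `x`-line commutes with the automorphism `x ↦ -x` of `E₁`. -/
lemma isRep_nsmul_of_xNum_eq_neg {P Q : E1QBar} (hP : P ≠ 0) (hQ : Q ≠ 0)
    (hPQ : xNum Q = -xNum P) (n : ℕ) : IsRep (n • Q) (-xNum (n • P)) (xDen (n • P)) := by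
  -- Two consecutive multiples are carried along, as the addition formula is a two-term recurrence;
  -- it is compatible with the sign change of `x`.
  have : ∀ k : ℕ, IsRep (k • Q) (-xNum (k • P)) (xDen (k • P)) ∧
      IsRep ((k + 1) • Q) (-xNum ((k + 1) • P)) (xDen ((k + 1) • P)) := by
    intro k
    induction k with
    | zero =>
      refine ⟨⟨-1, by simp, by simp, by simp⟩, ⟨1, one_ne_zero, by simp [hPQ], ?_⟩⟩
      simp [xDen_of_ne_zero hP, xDen_of_ne_zero hQ]
    | succ k ih =>
      refine ⟨ih.2, ?_⟩
      obtain ⟨l, hl, e1, e2, e3⟩ := exists_addSub ((k + 1) • P) P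
      obtain ⟨l', hl', f1, f2, f3⟩ := ih.2.exists_addSub hQ hPQ
      have s : ∀ R : E1QBar, (k + 1) • R + R = (k + 1 + 1) • R := fun R => (succ_nsmul R _).symm
      have d : ∀ R : E1QBar, (k + 1) • R - R = k • R := fun R => by
        rw [succ_nsmul, add_sub_cancel_right]
      rw [s, d] at e1 e2 e3 f1 f2 f3
      rw [xDen_of_ne_zero hP] at e1 e2 e3
      have := isRep_of_symmetric (S := (k + 1 + 1) • Q) (D := k • Q) (l := l' / l)
        (g := -xNum ((k + 1 + 1) • P)) (h := xDen ((k + 1 + 1) • P)) (div_ne_zero hl' hl) ih.1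
      apply this
      all_goals field_simp
      · linear_combination f1 - e1
      · linear_combination f2 + e2
      · linear_combination f3 - e3
  exact (this n).1

/-! ### Multiples of points of large abscissa. -/

/-- Error propagation for `recurrence_step`, with `q = g/f`, `r = η m²`, `t = (g - 1)/(m² - 1)` and
`s = m²/(X² g)`. The factor `4/3` bounds `m²/(m² - 1)` for `m ≥ 2`. -/
lemma norm_mul_sq_div_sub_one_le {q s t : ℂ} {b r : ℝ} (hb : b ≤ 1 / 100) (hr : r ≤ 1 / 100)
    (hq : ‖q - 1‖ ≤ b) (ht : ‖t‖ ≤ 4 / 3 * r) (hs : ‖s‖ ≤ 1 / 20 * r) :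
    t ≠ 1 ∧ ‖q * ((1 - s) / (1 - t)) ^ 2 - 1‖ ≤ b + 295 / 100 * r := by
  have hr0 : 0 ≤ r := by linarith [norm_nonneg t]
  have h1 : 1 - ‖t‖ ≤ ‖1 - t‖ := by simpa using norm_sub_norm_le (1 : ℂ) t
  have h2 : 98 / 100 ≤ ‖1 - t‖ := by linarith
  have h3 : 1 - t ≠ 0 := norm_pos_iff.1 (by linarith)
  refine ⟨fun h => h3 (by rw [h, sub_self]), ?_⟩
  set u := (1 - s) / (1 - t) with hu
  have hu1 : u - 1 = (t - s) / (1 - t) := by rw [hu]; field_simp; ring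
  have h4 : ‖t - s‖ ≤ 1384 / 1000 * r := (norm_sub_le _ _).trans (by linarith)
  have h5 : ‖u - 1‖ ≤ 1413 / 1000 * r := by
    rw [hu1, norm_div, div_le_iff₀ (by linarith)]
    nlinarith
  have h6 : ‖u + 1‖ ≤ 2015 / 1000 := by
    have : u + 1 = (u - 1) + 2 := by ring
    rw [this]
    refine (norm_add_le _ _).trans ?_
    rw [Complex.norm_ofNat]
    linarith
  have h7 : ‖u ^ 2 - 1‖ ≤ 285 / 100 * r := by
    have : u ^ 2 - 1 = (u - 1) * (u + 1) := by ring
    rw [this, norm_mul]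
    calc ‖u - 1‖ * ‖u + 1‖ ≤ (1413 / 1000 * r) * (2015 / 1000) := by gcongr
      _ ≤ _ := by linarith
  have : q * u ^ 2 - 1 = (q - 1) + (q - 1) * (u ^ 2 - 1) + (u ^ 2 - 1) := by ring
  rw [this]
  have h8 : ‖(q - 1) * (u ^ 2 - 1)‖ ≤ 1 / 100 * (285 / 100 * r) := by
    rw [norm_mul]
    gcongr
    exact hq.trans hb
  calc _ ≤ ‖q - 1‖ + ‖(q - 1) * (u ^ 2 - 1)‖ + ‖u ^ 2 - 1‖ := norm_add₃_le
    _ ≤ _ := by linarith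

/-- One step of the recurrence for the normalized abscissae `f`, `g`, `h` of three consecutive
multiples of a point of large abscissa. -/
lemma recurrence_step {m η : ℝ} {f g h X : ℂ} (hm : 2 ≤ m) (hX : X ≠ 0) (hη : η = 100 / ‖X‖ ^ 2)
    (hsmall : η * (m + 1) ^ 4 ≤ 1 / 100) (hf : f ≠ 0) (hg : ‖g - 1‖ ≤ η * m ^ 4)
    (hgf : ‖g / f - 1‖ ≤ 3 * η * (m - 1) ^ 3)
    (hrec : h * f * (g - m ^ 2) ^ 2 = (g - m ^ 2 / X ^ 2) ^ 2 * (m ^ 2 - 1) ^ 2) :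
    ‖h - 1‖ ≤ η * (m + 1) ^ 4 ∧ ‖h / g - 1‖ ≤ 3 * η * m ^ 3 := by
  have hXpos : 0 < ‖X‖ := norm_pos_iff.2 hX
  have hη0 : 0 < η := by rw [hη]; positivity
  have hm4 : 16 * (η * m ^ 2) ≤ 1 / 25 := by
    have : m ^ 2 * 4 ≤ (m + 1) ^ 4 := by nlinarith [sq_nonneg m]
    nlinarith
  have hmm : m ^ 4 ≤ (m + 1) ^ 4 := by gcongr; linarith
  have hg1 : ‖g - 1‖ ≤ 1 / 100 := hg.trans (le_trans (by gcongr) hsmall)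
  have hgn : 99 / 100 ≤ ‖g‖ := by
    have := norm_sub_norm_le (1 : ℂ) (1 - g)
    rw [norm_one, sub_sub_cancel, norm_sub_rev] at this
    linarith
  have hg0 : g ≠ 0 := norm_pos_iff.1 (by linarith)
  have hM : (m ^ 2 - 1 : ℂ) = ((m ^ 2 - 1 : ℝ) : ℂ) := by push_cast; ring
  have hMpos : 0 < m ^ 2 - 1 := by nlinarith
  have hMn : ‖(m ^ 2 - 1 : ℂ)‖ = m ^ 2 - 1 := by
    rw [hM, Complex.norm_real, Real.norm_of_nonneg hMpos.le]
  have hM0 : (m ^ 2 - 1 : ℂ) ≠ 0 := norm_pos_iff.1 (by rw [hMn]; exact hMpos)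
  have ht : ‖(g - 1) / (m ^ 2 - 1 : ℂ)‖ ≤ 4 / 3 * (η * m ^ 2) := by
    rw [norm_div, hMn, div_le_iff₀ hMpos]
    refine hg.trans ?_
    have : 0 ≤ η * m ^ 2 * (m ^ 2 - 4) := by
      have : 0 ≤ m ^ 2 - 4 := by nlinarith
      positivity
    nlinarith
  have hs : ‖(m : ℂ) ^ 2 / X ^ 2 / g‖ ≤ 1 / 20 * (η * m ^ 2) := by
    rw [norm_div, norm_div, norm_pow, norm_pow, Complex.norm_real, Real.norm_of_nonneg (by linarith),
      hη, div_le_iff₀ (by linarith)]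
    have : 0 ≤ m ^ 2 / ‖X‖ ^ 2 := by positivity
    have e : 1 / 20 * (100 / ‖X‖ ^ 2 * m ^ 2) * ‖g‖ = 5 * (m ^ 2 / ‖X‖ ^ 2) * ‖g‖ := by ring
    rw [e]
    nlinarith
  have hm3 : 3 * η * (m - 1) ^ 3 ≤ 1 / 100 := by
    have h1 : (m - 1) ^ 3 ≤ (m + 1) ^ 3 := by gcongr <;> linarith
    have h2 : 3 * (m + 1) ^ 3 ≤ (m + 1) ^ 4 := by
      have : 0 ≤ (m + 1) ^ 3 := by positivity
      nlinarith
    nlinarith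
  obtain ⟨ht1, hq⟩ := norm_mul_sq_div_sub_one_le hm3 (by linarith) hgf ht hs
  have ht1' : 1 - (g - 1) / (m ^ 2 - 1 : ℂ) ≠ 0 := sub_ne_zero.2 ht1.symm
  -- The recurrence solved for `h/g`: each ratio is the previous one times a factor close to `1`.
  have e : g / f * ((1 - (m : ℂ) ^ 2 / X ^ 2 / g) / (1 - (g - 1) / (m ^ 2 - 1 : ℂ))) ^ 2 = h / g := by
    have e1 : 1 - (g - 1) / (m ^ 2 - 1 : ℂ) = -(g - m ^ 2) / (m ^ 2 - 1 : ℂ) := by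
      field_simp; ring
    have e2 : 1 - (m : ℂ) ^ 2 / X ^ 2 / g = (g - m ^ 2 / X ^ 2) / g := by field_simp
    rw [e1] at ht1' ⊢
    have h0 : g - (m : ℂ) ^ 2 ≠ 0 := by
      intro h0
      simp [h0] at ht1'
    rw [e2, div_pow, div_pow, div_pow, neg_sq, div_mul_div_comm,
      div_eq_div_iff (mul_ne_zero hf (by positivity)) hg0]
    field_simp
    field_simp at hrec
    linear_combination -hrec
  rw [e] at hq
  have hq' : ‖h / g - 1‖ ≤ 3 * η * m ^ 3 := by
    refine hq.trans ?_
    -- The increment `9m² - 9m + 3` of `3m³` absorbs the new error `2.95 m²` when `m ≥ 2`.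
    have : 0 ≤ η * (3 * m ^ 3 - 3 * (m - 1) ^ 3 - 295 / 100 * m ^ 2) := by
      apply mul_nonneg hη0.le
      nlinarith
    nlinarith
  refine ⟨?_, hq'⟩
  have e3 : h - 1 = (h / g - 1) * (g - 1) + (h / g - 1) + (g - 1) := by field_simp; ring
  rw [e3]
  -- The added error is at most `3.03 η m³`, below the increment `4m³ + ...` of `m⁴`.
  calc _ ≤ ‖(h / g - 1) * (g - 1)‖ + ‖h / g - 1‖ + ‖g - 1‖ := norm_add₃_le
    _ ≤ (3 * η * m ^ 3) * (1 / 100) + 3 * η * m ^ 3 + η * m ^ 4 := by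
      rw [norm_mul]; gcongr
    _ ≤ _ := by
      have : 0 ≤ η * m ^ 3 := by positivity
      have : 0 ≤ η * (6 * m ^ 2 + 4 * m + 1) := by positivity
      nlinarith

/-- With `v = x(T)⁻²`, duplication reads `4x(2T)/x(T) = (1 - v)²/(1 + v)`. -/
lemma double_of_large {T : E1QBar} (hT : T ≠ 0) (hX : 400 ≤ ‖(xNum T : ℂ)‖) :
    2 • T ≠ 0 ∧ ‖4 * (xNum (2 • T) : ℂ) / xNum T - 1‖ ≤ 100 / ‖(xNum T : ℂ)‖ ^ 2 := by
  obtain ⟨l, hl, h1, h2⟩ := exists_double T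
  rw [← two_nsmul, xDen_of_ne_zero hT] at h1 h2
  set X : ℂ := (xNum T : ℂ) with hXdef
  have hX0 : X ≠ 0 := norm_pos_iff.1 (by linarith)
  have hXpos : 0 < ‖X‖ := by linarith
  have k1 : (X ^ 2 - 1) ^ 2 = (l : ℂ) * (xNum (2 • T) : ℂ) := by
    simpa using congrArg (fun z : QBar => (z : ℂ)) h1
  have k2 : 4 * X * (X ^ 2 + 1) = (l : ℂ) * (xDen (2 • T) : ℂ) := by
    have h4 : ((4 : QBar) : ℂ) = 4 := map_ofNat (algebraMap QBar ℂ) 4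
    simpa [h4] using congrArg (fun z : QBar => (z : ℂ)) h2
  set v : ℂ := 1 / X ^ 2 with hv
  have hvn : ‖v‖ = 1 / ‖X‖ ^ 2 := by rw [hv, norm_div, norm_pow, norm_one]
  have hv1 : ‖v‖ ≤ 1 / 100 := by
    rw [hvn, div_le_div_iff₀ (by positivity) (by norm_num)]
    nlinarith
  have hv2 : 99 / 100 ≤ ‖1 + v‖ := by
    have := norm_sub_norm_le (1 : ℂ) (-v)
    rw [norm_one, sub_neg_eq_add, norm_neg] at this
    linarith
  have hv0 : 1 + v ≠ 0 := norm_pos_iff.1 (by linarith)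
  have hXv : X ^ 2 + 1 = X ^ 2 * (1 + v) := by rw [hv]; field_simp
  have hT2 : 2 • T ≠ 0 := by
    intro h0
    rw [h0, xDen_zero, hXv] at k2
    simp [hX0, hv0] at k2
  refine ⟨hT2, ?_⟩
  rw [xDen_of_ne_zero hT2] at k2
  have hl' : (l : ℂ) = 4 * X * (X ^ 2 * (1 + v)) := by rw [← hXv, k2]; simp
  have k3 : 4 * (xNum (2 • T) : ℂ) / X - 1 = v * (v - 3) / (1 + v) := by
    rw [hl'] at k1
    have : (xNum (2 • T) : ℂ) = (X ^ 2 - 1) ^ 2 / (4 * X * (X ^ 2 * (1 + v))) := by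
      rw [k1]; field_simp
    rw [this]
    have : X ^ 2 * v = 1 := by rw [hv]; field_simp
    have e : X ^ 2 - 1 = X ^ 2 * (1 - v) := by linear_combination this
    rw [e]
    field_simp
    ring
  rw [k3, norm_div, norm_mul, div_le_iff₀ (by linarith)]
  have h3 : ‖v - 3‖ ≤ 4 := by
    refine (norm_sub_le _ _).trans ?_
    rw [Complex.norm_ofNat]
    linarith
  have h4 : 100 / ‖X‖ ^ 2 = 100 * ‖v‖ := by rw [hvn]; ring
  rw [h4]
  nlinarith [norm_nonneg v]

/-- `f` and `g` are the values of `m² x(mT)/x(T)` at `m = k + 1` and `m = k + 2`. The threshold on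
`x(T)` is what makes `η (k + 2)⁴ ≤ 1/100`, with `η = 100/|x(T)|²`. -/
lemma multiples_of_large {T : E1QBar} (hT : T ≠ 0) (k : ℕ)
    (hX : 100 * ((k : ℝ) + 2) ^ 2 ≤ ‖(xNum T : ℂ)‖) :
    (k + 1) • T ≠ 0 ∧ (k + 2) • T ≠ 0 ∧ ∃ f g : ℂ, f ≠ 0 ∧
      f * xNum T = ((k : ℂ) + 1) ^ 2 * xNum ((k + 1) • T) ∧
      g * xNum T = ((k : ℂ) + 2) ^ 2 * xNum ((k + 2) • T) ∧
      ‖g - 1‖ ≤ 100 / ‖(xNum T : ℂ)‖ ^ 2 * ((k : ℝ) + 2) ^ 4 ∧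
      ‖g / f - 1‖ ≤ 3 * (100 / ‖(xNum T : ℂ)‖ ^ 2) * ((k : ℝ) + 1) ^ 3 := by
  induction k with
  | zero =>
    norm_num at hX
    obtain ⟨h2, hg⟩ := double_of_large hT hX
    have hX0 : (xNum T : ℂ) ≠ 0 := norm_pos_iff.1 (by linarith)
    have hpos : 0 ≤ 100 / ‖(xNum T : ℂ)‖ ^ 2 := by positivity
    refine ⟨by simpa using hT, h2, 1, 4 * (xNum (2 • T) : ℂ) / xNum T, one_ne_zero, by simp, ?_, ?_,
      ?_⟩
    · rw [div_mul_cancel₀ _ hX0]; norm_num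
    · refine hg.trans ?_
      norm_num
      linarith
    · rw [div_one]
      refine hg.trans ?_
      norm_num
      linarith
  | succ k ih =>
    push_cast at hX ⊢
    obtain ⟨hP, hQ, f, g, hf, hfX, hgX, hg, hgf⟩ := ih (le_trans (by gcongr; linarith) hX)
    set X : ℂ := (xNum T : ℂ) with hXdef
    have hk : (0 : ℝ) ≤ k := Nat.cast_nonneg k
    have hXpos : 0 < ‖X‖ := lt_of_lt_of_le (by positivity) hX
    have hX0 : X ≠ 0 := norm_pos_iff.1 hXpos
    set η := 100 / ‖X‖ ^ 2 with hη
    have hsmall : η * ((k : ℝ) + 2 + 1) ^ 4 ≤ 1 / 100 := by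
      rw [hη, div_mul_eq_mul_div, div_le_iff₀ (by positivity)]
      have := pow_le_pow_left₀ (by positivity) hX 2
      have e : (100 * ((k : ℝ) + 1 + 2) ^ 2) ^ 2 = 10000 * ((k : ℝ) + 2 + 1) ^ 4 := by ring
      rw [e] at this
      linarith
    have hg1 : ‖g - 1‖ ≤ 1 / 100 := hg.trans (le_trans (by gcongr ?_ * ?_ ^ 4; linarith) hsmall)
    obtain ⟨l, hl, h1, -, h3⟩ := exists_addSub ((k + 2) • T) T
    have s1 : (k + 2) • T + T = (k + 1 + 2) • T := by rw [← succ_nsmul, add_right_comm]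
    have s2 : (k + 2) • T - T = (k + 1) • T := by
      rw [show k + 2 = k + 1 + 1 from rfl, succ_nsmul, add_sub_cancel_right]
    rw [s1, s2, xDen_of_ne_zero hT, xDen_of_ne_zero hP, xDen_of_ne_zero hQ] at h3
    rw [s1, s2, xDen_of_ne_zero hT, xDen_of_ne_zero hQ] at h1
    -- Equality would give `g = (k + 2)² ≥ 4`, far from `1`. Hence `(k + 3)T ≠ O`.
    have hne : (xNum ((k + 2) • T) : ℂ) ≠ X := by
      intro h0
      rw [h0] at hgX
      have hg2 : g = ((k : ℂ) + 2) ^ 2 := mul_right_cancel₀ hX0 hgX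
      have hgn : ‖g‖ = ((k : ℝ) + 2) ^ 2 := by
        have : ((k : ℂ) + 2) ^ 2 = ((((k : ℝ) + 2) ^ 2 : ℝ) : ℂ) := by push_cast; ring
        rw [hg2, this, Complex.norm_real, Real.norm_of_nonneg (by positivity)]
      have := norm_sub_norm_le g 1
      rw [norm_one, hgn] at this
      nlinarith
    have hS : (k + 1 + 2) • T ≠ 0 := by
      intro h0
      rw [h0, xDen_zero] at h3
      apply hne
      have h4 : xNum ((k + 2) • T) = xNum T := by
        simpa [sub_eq_zero] using h3
      rw [h4]
    rw [xDen_of_ne_zero hS] at h3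
    have k1 : ((xNum ((k + 2) • T) : ℂ) * X - 1) ^ 2 =
        (l : ℂ) * ((xNum ((k + 1 + 2) • T) : ℂ) * (xNum ((k + 1) • T) : ℂ)) := by
      simpa using congrArg (fun z : QBar => (z : ℂ)) h1
    have k3 : ((xNum ((k + 2) • T) : ℂ) - X) ^ 2 = (l : ℂ) := by
      simpa using congrArg (fun z : QBar => (z : ℂ)) h3
    set x₀ : ℂ := (xNum ((k + 1) • T) : ℂ)
    set x₁ : ℂ := (xNum ((k + 2) • T) : ℂ)
    set x₂ : ℂ := (xNum ((k + 1 + 2) • T) : ℂ)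
    have hc1 : (k : ℂ) + 1 ≠ 0 := by exact_mod_cast k.succ_ne_zero
    have hc2 : (k : ℂ) + 2 ≠ 0 := by exact_mod_cast (k + 1).succ_ne_zero
    have hg0 : g ≠ 0 := by
      rintro rfl
      norm_num at hg1
    have e0 : x₀ = f * X / ((k : ℂ) + 1) ^ 2 := by rw [hfX]; field_simp
    have e1 : x₁ = g * X / ((k : ℂ) + 2) ^ 2 := by rw [hgX]; field_simp
    have hrec : ((k : ℂ) + 3) ^ 2 * x₂ / X * f * (g - (((k : ℝ) + 2 : ℝ) : ℂ) ^ 2) ^ 2 =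
        (g - (((k : ℝ) + 2 : ℝ) : ℂ) ^ 2 / X ^ 2) ^ 2 * ((((k : ℝ) + 2 : ℝ) : ℂ) ^ 2 - 1) ^ 2 := by
      rw [← k3, e0, e1] at k1
      push_cast
      have e2 : ((k : ℂ) + 2) ^ 2 - 1 = (k + 1) * (k + 3) := by ring
      rw [e2]
      field_simp at k1 ⊢
      linear_combination -((k : ℂ) + 3) ^ 2 * k1
    have e3 : (k : ℝ) + 2 - 1 = k + 1 := by ring
    obtain ⟨r1, r2⟩ := recurrence_step (by linarith) hX0 hη hsmall hf hg (by rwa [e3]) hrec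
    have e4 : (k : ℝ) + 2 + 1 = k + 1 + 2 := by ring
    have e5 : (k : ℝ) + 2 = k + 1 + 1 := by ring
    have e6 : (k : ℂ) + 2 = k + 1 + 1 := by ring
    refine ⟨hQ, hS, g, ((k : ℂ) + 3) ^ 2 * x₂ / X, hg0, ?_, ?_, ?_, ?_⟩
    · rw [hgX, e6]
    · rw [div_mul_cancel₀ _ hX0]; ring
    · rwa [e4] at r1
    · rwa [e5] at r2

/-- Nontrivial `n`-torsion points of `E₁` have abscissa `O(n²)`. -/
lemma norm_xNum_lt_of_nsmul_eq_zero {T : E1QBar} (hT : T ≠ 0) {n : ℕ} (hn : 2 ≤ n)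
    (h : n • T = 0) : ‖(xNum T : ℂ)‖ < 100 * (n : ℝ) ^ 2 := by
  obtain ⟨k, rfl⟩ := Nat.exists_eq_add_of_le' hn
  by_contra! hlt
  push_cast at hlt
  exact (multiples_of_large hT k hlt).2.1 h

/-! ### The separation bound. -/

lemma abscissa_eq {T : E1QBar} (hT : T ≠ 0) : abscissa T = (xNum T : ℂ) := by
  rcases T with _ | ⟨x, y, h⟩
  · exact absurd rfl hT
  · rfl

lemma norm_sub_ge_of_addSub {a b s d : ℂ} {B : ℝ} (hB : 1 ≤ B) (hs : ‖s‖ ≤ B) (hd : ‖d‖ ≤ B)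
    (h1 : (a * b - 1) ^ 2 = (a - b) ^ 2 * (s * d))
    (h2 : 2 * (a + b) * (a * b + 1) = (a - b) ^ 2 * (s + d)) : 1 / (10 * B) ≤ ‖a - b‖ := by
  by_contra! hlt
  have hδ : ‖a - b‖ * (10 * B) < 1 := (lt_div_iff₀ (by linarith)).1 hlt
  have hδ0 := norm_nonneg (a - b)
  have hδB : ‖a - b‖ * B ≤ 1 / 10 := by linarith
  have hδ1 : ‖a - b‖ ≤ 1 / 10 := by nlinarith
  have p1 : ‖a * b - 1‖ ≤ 1 / 10 := by
    have : ‖a * b - 1‖ ^ 2 ≤ (‖a - b‖ * B) ^ 2 := by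
      rw [← norm_pow, h1, norm_mul, norm_mul, norm_pow, mul_pow, sq B]
      gcongr
    exact (abs_le_of_sq_le_sq' this (by positivity)).2.trans hδB
  have p2 : 19 / 10 ≤ ‖a * b + 1‖ := by
    have := norm_sub_norm_le (2 : ℂ) (1 - a * b)
    rw [Complex.norm_ofNat, norm_sub_rev, show (2 : ℂ) - (1 - a * b) = a * b + 1 by ring] at this
    linarith
  have p3 : 1 ≤ ‖a + b‖ := by
    -- That is, `(a + b)² = 4ab + (a - b)²` with `ab ≈ 1`, so `a + b` stays away from `0`.
    have e : (a + b) ^ 2 = 4 - (-(4 * (a * b - 1)) - (a - b) ^ 2) := by ring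
    have := norm_sub_norm_le (4 : ℂ) (-(4 * (a * b - 1)) - (a - b) ^ 2)
    rw [← e, Complex.norm_ofNat] at this
    have := norm_sub_le (-(4 * (a * b - 1))) ((a - b) ^ 2)
    rw [norm_neg, norm_mul, Complex.norm_ofNat, norm_pow] at this
    have h3 : 1 ≤ ‖a + b‖ ^ 2 := by
      rw [← norm_pow]
      nlinarith
    nlinarith [norm_nonneg (a + b)]
  have p4 : 2 * ‖a + b‖ * ‖a * b + 1‖ ≤ ‖a - b‖ ^ 2 * (B + B) := by
    calc 2 * ‖a + b‖ * ‖a * b + 1‖ = ‖2 * (a + b) * (a * b + 1)‖ := by simp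
      _ = ‖a - b‖ ^ 2 * ‖s + d‖ := by rw [h2, norm_mul, norm_pow]
      _ ≤ _ := by
        gcongr
        exact (norm_add_le _ _).trans (add_le_add hs hd)
  nlinarith

lemma separation_ge {n : ℕ} (hn : 2 ≤ n) {δ : ℝ} (h : δ ∈ separations n) :
    1 / (1000 * (n : ℝ) ^ 2) ≤ δ := by
  obtain ⟨P, ⟨hPn, hP⟩, Q, ⟨hQn, hQ⟩, hne, hne', h⟩ := h
  have hS : P + Q ≠ 0 := fun h0 => hne' (eq_neg_of_add_eq_zero_left h0)
  have hD : P - Q ≠ 0 := sub_ne_zero.2 hne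
  have bS := norm_xNum_lt_of_nsmul_eq_zero hS hn (by rw [nsmul_add, hPn, hQn, add_zero])
  have bD := norm_xNum_lt_of_nsmul_eq_zero hD hn (by rw [nsmul_sub, hPn, hQn, sub_zero])
  obtain ⟨l, -, h1, h2, h3⟩ := exists_addSub P Q
  rw [xDen_of_ne_zero hS, xDen_of_ne_zero hD, xDen_of_ne_zero hP, xDen_of_ne_zero hQ] at h2 h3
  rw [xDen_of_ne_zero hP, xDen_of_ne_zero hQ] at h1
  rw [abscissa_eq hP, abscissa_eq hQ] at h
  have hl : l = (xNum P - xNum Q) ^ 2 := by linear_combination -h3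
  rw [hl] at h1 h2
  have k1 : ((xNum P : ℂ) * (xNum Q : ℂ) - 1) ^ 2 =
      ((xNum P : ℂ) - (xNum Q : ℂ)) ^ 2 * ((xNum (P + Q) : ℂ) * (xNum (P - Q) : ℂ)) := by
    simpa using congrArg (fun z : QBar => (z : ℂ)) h1
  have k2 : 2 * ((xNum P : ℂ) + (xNum Q : ℂ)) * ((xNum P : ℂ) * (xNum Q : ℂ) + 1) =
      ((xNum P : ℂ) - (xNum Q : ℂ)) ^ 2 * ((xNum (P + Q) : ℂ) + (xNum (P - Q) : ℂ)) := by
    have h4 : ((2 : QBar) : ℂ) = 2 := map_ofNat (algebraMap QBar ℂ) 2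
    simpa [h4] using congrArg (fun z : QBar => (z : ℂ)) h2
  have hB : (1 : ℝ) ≤ 100 * (n : ℝ) ^ 2 := by
    have : (2 : ℝ) ≤ n := by exact_mod_cast hn
    nlinarith
  have e : 1 / (1000 * (n : ℝ) ^ 2) = 1 / (10 * (100 * (n : ℝ) ^ 2)) := by ring
  rw [e]
  rcases h with rfl | ⟨h0, rfl⟩
  · exact norm_sub_ge_of_addSub hB bS.le bD.le k1 k2
  · have ha := left_ne_zero_of_mul h0
    have hb := right_ne_zero_of_mul h0
    -- Both relations survive inverting `a` and `b` with `s`, `d` unchanged: translation by the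
    -- 2-torsion point `(0, 0)` inverts abscissae and preserves the sum and difference.
    refine norm_sub_ge_of_addSub hB bS.le bD.le ?_ ?_
    · field_simp
      linear_combination k1
    · field_simp
      linear_combination k2

/-! ### Existence of the minimum. -/

lemma finite_separations {n : ℕ} (hn : 1 ≤ n) : (separations n).Finite := by
  obtain ⟨A, B, h⟩ := exists_isMulPoly n hn
  have hB : B ≠ 0 := by
    rw [← leadingCoeff_ne_zero, h.leadingCoeff_den]
    exact pow_ne_zero 2 (Nat.cast_ne_zero.2 (by lia))
  have hfin : {z : ℂ | ∃ T ∈ nontrivialTorsion n, abscissa T = z}.Finite := by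
    refine ((B.finite_setOfPred_isRoot hB).image (fun x : QBar => (x : ℂ))).subset ?_
    rintro _ ⟨T, ⟨hTn, hT⟩, rfl⟩
    exact ⟨xNum T, (h.isRep T hT).eq_zero_iff.2 hTn, (abscissa_eq hT).symm⟩
  refine ((hfin.image2 (fun a b => ‖a - b‖) hfin).union
    (hfin.image2 (fun a b => ‖a⁻¹ - b⁻¹‖) hfin)).subset ?_
  rintro δ ⟨P, hP, Q, hQ, -, -, rfl | ⟨-, rfl⟩⟩
  · exact Or.inl ⟨_, ⟨P, hP, rfl⟩, _, ⟨Q, hQ, rfl⟩, rfl⟩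
  · exact Or.inr ⟨_, ⟨P, hP, rfl⟩, _, ⟨Q, hQ, rfl⟩, rfl⟩

lemma two_nsmul_eq_zero_iff {T : E1QBar} (hT : T ≠ 0) :
    2 • T = 0 ↔ xNum T ^ 3 + xNum T = 0 := by
  obtain ⟨l, hl, -, h2⟩ := exists_double T
  rw [← two_nsmul, xDen_of_ne_zero hT] at h2
  rw [← xDen_eq_zero_iff]
  constructor
  · intro h0
    rw [h0] at h2
    linear_combination h2 / 4
  · intro h0
    apply mul_left_cancel₀ hl
    linear_combination 4 * h0 - h2

lemma ne_and_ne_neg_of_xNum_ne {P Q : E1QBar} (h : xNum P ≠ xNum Q) : P ≠ Q ∧ P ≠ -Q :=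
  ⟨by rintro rfl; exact h rfl, by rintro rfl; exact h (xNum_neg Q)⟩

lemma nonempty_separations {n : ℕ} (hn : 2 ≤ n) : (separations n).Nonempty := by
  suffices ∃ P ∈ nontrivialTorsion n, ∃ Q ∈ nontrivialTorsion n, xNum P ≠ xNum Q by
    obtain ⟨P, hP, Q, hQ, h⟩ := this
    obtain ⟨h1, h2⟩ := ne_and_ne_neg_of_xNum_ne h
    exact ⟨_, P, hP, Q, hQ, h1, h2, Or.inl rfl⟩
  have even_torsion {T : E1QBar} (hT : 2 • T = 0) {k : ℕ} (hk : Even k) : k • T = 0 := by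
    obtain ⟨j, rfl⟩ := hk
    rw [← two_mul, mul_nsmul, hT, nsmul_zero]
  rcases Nat.even_or_odd n with he | ho
  -- For even `n`, the 2-torsion abscissae `0` and `i` suffice.
  · obtain ⟨P, hPx, hP⟩ := exists_point 0
    obtain ⟨i, hi⟩ := IsAlgClosed.exists_pow_nat_eq (-1 : QBar) (n := 2) (by norm_num)
    obtain ⟨Q, hQx, hQ⟩ := exists_point i
    refine ⟨P, ⟨even_torsion ?_ he, hP⟩, Q, ⟨even_torsion ?_ he, hQ⟩, ?_⟩
    · rw [two_nsmul_eq_zero_iff hP, hPx]; ring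
    · rw [two_nsmul_eq_zero_iff hQ, hQx]; linear_combination i * hi
    · rw [hPx, hQx]
      rintro rfl
      norm_num at hi
  · obtain ⟨A, B, h⟩ := exists_isMulPoly n (by lia)
    have hdeg : B.degree ≠ 0 := by
      intro h0
      have := h.natDegree_den
      rw [(natDegree_eq_of_degree_eq_some h0 : B.natDegree = 0)] at this
      nlinarith
    -- For odd `n`, take an `n`-torsion abscissa and its negative. They differ, since abscissa `0`
    -- means order `2`.
    obtain ⟨x, hx⟩ := IsAlgClosed.exists_root B hdeg
    obtain ⟨P, rfl, hP⟩ := exists_point x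
    obtain ⟨Q, hQx, hQ⟩ := exists_point (-xNum P)
    have hPn : n • P = 0 := (h.isRep P hP).eq_zero_iff.1 hx
    have hQn : n • Q = 0 :=
      (isRep_nsmul_of_xNum_eq_neg hP hQ hQx n).eq_zero_iff.1 (xDen_eq_zero_iff.2 hPn)
    refine ⟨P, ⟨hPn, hP⟩, Q, ⟨hQn, hQ⟩, ?_⟩
    intro h0
    rw [hQx] at h0
    have hP0 : xNum P = 0 := by linear_combination h0 / 2
    have h2 : 2 • P = 0 := by rw [two_nsmul_eq_zero_iff hP, hP0]; ring
    obtain ⟨k, rfl⟩ := ho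
    rw [succ_nsmul, even_torsion h2 (even_two_mul k), zero_add] at hPn
    exact hP hPn

theorem mainTheorem5 (n : ℕ) (hn : 2 ≤ n) :
    IsLeast (separations n) (minSeparation n) ∧
      minSeparation n ≥ 1 / (2.5 * 10 ^ 36 * (n : ℝ) ^ 6) := by
  have hmem : minSeparation n ∈ separations n :=
    (nonempty_separations hn).csInf_mem (finite_separations (by lia))
  have hlb : ∀ δ ∈ separations n, 1 / (1000 * (n : ℝ) ^ 2) ≤ δ := fun δ h => separation_ge hn h
  refine ⟨⟨hmem, fun δ h => csInf_le ⟨_, hlb⟩ h⟩, le_trans ?_ (hlb _ hmem)⟩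
  have hn1 : (1 : ℝ) ≤ n := by exact_mod_cast (by lia : 1 ≤ n)
  -- The bound `1/(1000 n²)` is weakened to the stated one.
  refine one_div_le_one_div_of_le (by positivity) (mul_le_mul (by norm_num) ?_ ?_ (by norm_num))
  · exact pow_le_pow_right₀ hn1 (by norm_num)
  · positivity
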